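/- Let $R\in\mathbb{C}[t]$ be a polynomial of degree $3$ or $4$ with simple roots, and call *roots of $R$ on $\mathbb{P}^1(\mathbb{C})=\mathbb{C}\cup\{\infty\}$* its roots in $\mathbb{C}$ together with $\infty$ if $\deg R=3$. Let $S\in\mathrm{PGL}_2(\mathbb{C})$ be a Möbius involution ($S^2=\mathrm{id}$, $S\ne\mathrm{id}$) that permutes the four roots of $R$ on $\mathbb{P}^1(\mathbb{C})$ in pairs, i.e. maps this set to itself and fixes none of its elements. Let $F\in\mathbb{C}(t)$ satisfy $F(t)+F(S(t))=0$ identically. Then $\int F(t)\,dt/\sqrt{R(t)}$ is pseudo-elliptic: the element $F/\sqrt R$ of the differential field $\mathbb{C}(t,\sqrt R)$ (with derivation $d/dt$) has an antiderivative in an elementary extension, that is, in a differential field extension obtained by finitely many adjunctions $K_{i+1}=K_i(\theta_i)$ in which $\theta_i$ is algebraic over $K_i$, or an exponential ($\theta_i\neq 0$, $\theta_i'/\theta_i\in K_i$), or a logarithm ($\theta_i'=\eta'/\eta$ with $0\ne\eta\in K_i$). Moreover $S$ has exactly two fixed points in $\mathbb{P}^1(\mathbb{C})$. If $\alpha,\beta$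 are these two points, in either order, and $$u=\frac{t-\alpha}{t-\beta},\qquad x=u^2$$ (a factor $t-\infty$ being read as $1$), then there are $G\in\mathbb{C}(x)$ and a quadratic polynomial $Q\in\mathbb{C}[x]$ with two distinct roots such that, under this substitution and for a suitable choice of $\sqrt{Q(x)}$ in $\mathbb{C}(t,\sqrt R)$, $$\frac{F(t)\,dt}{\sqrt{R(t)}}=\frac{G(x)\,dx}{2\sqrt{Q(x)}},\qquad\text{hence}\qquad \int F(t)\,\frac{dt}{\sqrt{R(t)}}=\int\frac{G(x)\,dx}{2\sqrt{Q(x)}},$$ and the latter integral is elementary, i.e. $G/(2\sqrt Q)\in\mathbb{C}(x,\sqrt Q)$ (with derivation $d/dx$) has an antiderivative in an elementary extension of $\mathbb{C}(x,\sqrt Q)$. -/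

import Mathlib

open scoped Differential OnePoint Polynomial MatrixGroups

noncomputable section

namespace Goursat

/-! ### The differential field `ℂ(t)` -/

/-- The derivative `d/dt` of a rational function, by the quotient rule. -/
def ratDeriv (f : RatFunc ℂ) : RatFunc ℂ :=
  (algebraMap ℂ[X] (RatFunc ℂ) (Polynomial.derivative f.num) * algebraMap ℂ[X] (RatFunc ℂ) f.denom
    - algebraMap ℂ[X] (RatFunc ℂ) f.num
      * algebraMap ℂ[X] (RatFunc ℂ) (Polynomial.derivative f.denom))
    / (algebraMap ℂ[X] (RatFunc ℂ) f.denom) ^ 2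

theorem algebraMap_ne_zero' {q : ℂ[X]} (hq : q ≠ 0) : algebraMap ℂ[X] (RatFunc ℂ) q ≠ 0 :=
  RatFunc.algebraMap_ne_zero hq

theorem ratDeriv_div (p q : ℂ[X]) (hq : q ≠ 0) :
    ratDeriv (algebraMap ℂ[X] (RatFunc ℂ) p / algebraMap ℂ[X] (RatFunc ℂ) q) =
      (algebraMap ℂ[X] (RatFunc ℂ) (Polynomial.derivative p) * algebraMap ℂ[X] (RatFunc ℂ) q
        - algebraMap ℂ[X] (RatFunc ℂ) p * algebraMap ℂ[X] (RatFunc ℂ) (Polynomial.derivative q))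
        / (algebraMap ℂ[X] (RatFunc ℂ) q) ^ 2 := by
  set f : RatFunc ℂ := algebraMap ℂ[X] (RatFunc ℂ) p / algebraMap ℂ[X] (RatFunc ℂ) q with hf
  have hd : f.denom ≠ 0 := f.denom_ne_zero
  have hq' := algebraMap_ne_zero' hq
  have hd' := algebraMap_ne_zero' hd
  have h1 : algebraMap ℂ[X] (RatFunc ℂ) f.num * algebraMap ℂ[X] (RatFunc ℂ) q
      = algebraMap ℂ[X] (RatFunc ℂ) p * algebraMap ℂ[X] (RatFunc ℂ) f.denom := by
    have h := f.num_div_denom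
    rw [div_eq_iff hd'] at h
    rw [h, hf]
    field_simp
  have h2 : f.num * q = p * f.denom := by
    apply RatFunc.algebraMap_injective ℂ
    simpa using h1
  have h3 := congrArg (fun r => algebraMap ℂ[X] (RatFunc ℂ) (Polynomial.derivative r)) h2
  simp only [Polynomial.derivative_mul, map_add, map_mul] at h3
  unfold ratDeriv
  rw [div_eq_div_iff (pow_ne_zero 2 hd') (pow_ne_zero 2 hq')]
  linear_combination (algebraMap ℂ[X] (RatFunc ℂ) q * algebraMap ℂ[X] (RatFunc ℂ) f.denom) * h3
    - (algebraMap ℂ[X] (RatFunc ℂ) f.denom * algebraMap ℂ[X] (RatFunc ℂ) (Polynomial.derivative q)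
      + algebraMap ℂ[X] (RatFunc ℂ) q
        * algebraMap ℂ[X] (RatFunc ℂ) (Polynomial.derivative f.denom)) * h1

theorem exists_div (f : RatFunc ℂ) : ∃ p q : ℂ[X], q ≠ 0 ∧
    f = algebraMap ℂ[X] (RatFunc ℂ) p / algebraMap ℂ[X] (RatFunc ℂ) q :=
  ⟨f.num, f.denom, f.denom_ne_zero, f.num_div_denom.symm⟩

theorem ratDeriv_add (f g : RatFunc ℂ) : ratDeriv (f + g) = ratDeriv f + ratDeriv g := by
  obtain ⟨p, q, hq, rfl⟩ := exists_div f
  obtain ⟨r, s, hs, rfl⟩ := exists_div g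
  have hq' := algebraMap_ne_zero' hq
  have hs' := algebraMap_ne_zero' hs
  rw [div_add_div _ _ hq' hs', ← map_mul, ← map_mul, ← map_add, ← map_mul,
    ratDeriv_div _ _ (mul_ne_zero hq hs), ratDeriv_div _ _ hq, ratDeriv_div _ _ hs]
  simp only [Polynomial.derivative_mul, map_add, map_mul]
  field_simp
  ring

theorem ratDeriv_mul (f g : RatFunc ℂ) : ratDeriv (f * g) = f * ratDeriv g + g * ratDeriv f := by
  obtain ⟨p, q, hq, rfl⟩ := exists_div f
  obtain ⟨r, s, hs, rfl⟩ := exists_div g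
  have hq' := algebraMap_ne_zero' hq
  have hs' := algebraMap_ne_zero' hs
  rw [div_mul_div_comm, ← map_mul, ← map_mul,
    ratDeriv_div _ _ (mul_ne_zero hq hs), ratDeriv_div _ _ hq, ratDeriv_div _ _ hs]
  simp only [Polynomial.derivative_mul, map_add, map_mul]
  field_simp
  ring

/-- A map that is additive and satisfies the Leibniz rule, as a derivation. -/
@[reducible]
def mkDifferential {K : Type*} [CommRing K] (D : K → K) (hadd : ∀ a b, D (a + b) = D a + D b)
    (hmul : ∀ a b, D (a * b) = a * D b + b * D a) : Differential K where
  deriv := Derivation.mk' (AddMonoidHom.mk' D hadd).toIntLinearMap (fun a b => hmul a b)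

/-- `ℂ(t)` is a differential field with the derivation `d/dt`. -/
instance ratFuncDifferential : Differential (RatFunc ℂ) :=
  mkDifferential ratDeriv ratDeriv_add ratDeriv_mul

/-! ### Elementary extensions and elementary integrals -/

section Elementary

universe u

variable (K L : Type u) [Field K] [Field L] [Differential L] [Algebra K L]

/-- `θ` is algebraic over `E`, or an exponential over `E`, or a logarithm over `E`. -/
def IsElementaryGenerator {K L : Type u} [Field K] [Field L] [Differential L] [Algebra K L]
    (E : IntermediateField K L) (θ : L) : Prop :=
  IsAlgebraic E θ ∨ (θ ≠ 0 ∧ θ′ / θ ∈ E) ∨ (∃ η ∈ E, η ≠ 0 ∧ θ′ = η′ / η)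

/-- The fields that are the top of a finite tower `K = K₀ ⊆ K₁ ⊆ ⋯ ⊆ Kₙ` inside `L` with
`Kᵢ₊₁ = Kᵢ(θᵢ)`, each `θᵢ` being algebraic, an exponential or a logarithm over `Kᵢ`. -/
inductive IsElementaryTower : IntermediateField K L → Prop
  | base : IsElementaryTower ⊥
  | step (E : IntermediateField K L) (θ : L) (hE : IsElementaryTower E)
      (hθ : IsElementaryGenerator E θ) :
      IsElementaryTower (E ⊔ IntermediateField.adjoin K {θ})

/-- The differential field extension `L / K` is elementary. -/
def IsElementaryExtension : Prop := IsElementaryTower K L ⊤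

/-- `f ∈ K` has an antiderivative in some elementary differential field extension of `K`. -/
def HasElementaryIntegral {K : Type u} [Field K] [CharZero K] [Differential K] (f : K) : Prop :=
  ∃ (L : Type u) (_ : Field L) (_ : Differential L) (_ : Algebra K L)
    (_ : DifferentialAlgebra K L),
    IsElementaryExtension K L ∧ ∃ g : L, g′ = algebraMap K L f

end Elementary

/-! ### The differential field `ℂ(t, √P)` -/

/-- A square root of the polynomial `P` in the algebraic closure of `ℂ(t)`. -/
def sqrtClosure (P : ℂ[X]) : AlgebraicClosure (RatFunc ℂ) :=
  (IsAlgClosed.exists_pow_nat_eq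
    (algebraMap (RatFunc ℂ) (AlgebraicClosure (RatFunc ℂ)) (algebraMap ℂ[X] (RatFunc ℂ) P))
    two_pos).choose

/-- The field `ℂ(t, √P)`. -/
abbrev SqrtField (P : ℂ[X]) : IntermediateField (RatFunc ℂ) (AlgebraicClosure (RatFunc ℂ)) :=
  IntermediateField.adjoin (RatFunc ℂ) {sqrtClosure P}

/-- `ℂ(t, √P)` is finite over `ℂ(t)`, so Mathlib equips it with the unique derivation that
extends `d/dt`. -/
instance sqrtFieldFinite (P : ℂ[X]) : FiniteDimensional (RatFunc ℂ) (SqrtField P) :=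
  IntermediateField.adjoin.finiteDimensional
    (Algebra.IsIntegral.isIntegral (R := RatFunc ℂ) (sqrtClosure P))

/-- The element `√P` of `ℂ(t, √P)`. -/
def sqrtOf (P : ℂ[X]) : SqrtField P :=
  ⟨sqrtClosure P, IntermediateField.mem_adjoin_simple_self _ _⟩

theorem sqrtOf_sq (P : ℂ[X]) :
    sqrtOf P ^ 2 = algebraMap (RatFunc ℂ) (SqrtField P) (algebraMap ℂ[X] (RatFunc ℂ) P) :=
  Subtype.ext (IsAlgClosed.exists_pow_nat_eq
    (algebraMap (RatFunc ℂ) (AlgebraicClosure (RatFunc ℂ)) (algebraMap ℂ[X] (RatFunc ℂ) P))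
    two_pos).choose_spec

/-- The integral `∫ F(t) dt / √(R(t))` is elementary. -/
def IsPseudoElliptic (R : ℂ[X]) (F : RatFunc ℂ) : Prop :=
  HasElementaryIntegral (algebraMap (RatFunc ℂ) (SqrtField R) F / sqrtOf R)

/-! ### Möbius involutions

A Möbius transformation is represented by an invertible matrix, acting on
`ℙ¹(ℂ) = OnePoint ℂ` by `z ↦ (A z + B) / (C z + D)`. -/

/-- The class of `S` in `PGL₂(ℂ)`, the quotient of `GL₂(ℂ)` by its centre, has order two. -/
def IsMobiusInvolution (S : GL (Fin 2) ℂ) : Prop :=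
  S ^ 2 ∈ Subgroup.center (GL (Fin 2) ℂ) ∧ S ∉ Subgroup.center (GL (Fin 2) ℂ)

/-- The roots of `R` on the projective line; a cubic has `∞` as its fourth root. -/
def projRoots (R : ℂ[X]) : Set (OnePoint ℂ) :=
  {z | (∃ a : ℂ, z = (a : OnePoint ℂ) ∧ R.IsRoot a) ∨ (z = ∞ ∧ R.natDegree = 3)}

/-- `S` maps the set of roots to itself and fixes none of them, so that an involution `S`
permutes the roots in pairs. -/
def PermutesInPairs (S : GL (Fin 2) ℂ) (R : ℂ[X]) : Prop :=
  ∀ z ∈ projRoots R, S • z ∈ projRoots R ∧ S • z ≠ z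

/-- The rational function `S(t) = (A t + B) / (C t + D)`. -/
def mobiusFun (S : GL (Fin 2) ℂ) : RatFunc ℂ :=
  (RatFunc.C (S 0 0) * RatFunc.X + RatFunc.C (S 0 1)) /
    (RatFunc.C (S 1 0) * RatFunc.X + RatFunc.C (S 1 1))

/-- The rational function `F(S(t))`. -/
def compMobius (F : RatFunc ℂ) (S : GL (Fin 2) ℂ) : RatFunc ℂ :=
  RatFunc.eval RatFunc.C (mobiusFun S) F

/-- The factor `t - a`, read as `1` for `a = ∞`. -/
def linFactor : OnePoint ℂ → RatFunc ℂ
  | ∞ => 1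
  | (a : ℂ) => RatFunc.X - RatFunc.C a

/-- The coordinate `u = (t - α) / (t - β)`; it is `t - α` for `β = ∞`, and `1 / (t - β)` for
`α = ∞`. -/
def fixCoord (α β : OnePoint ℂ) : RatFunc ℂ := linFactor α / linFactor β

end Goursat

end

/-! An involution `S` is represented by a matrix of trace zero, and its fixed points `α`, `β` are
eigenvectors for opposite eigenvalues; hence `S` acts on the coordinate `u = (t - α) / (t - β)` by
`u ↦ -u`. So `F`, being odd under `S`, has the form `u b(u²)`. The four roots of `R` form two pairs
with coordinates `±v` and `±w`, so `(du/dt)² R` is a constant multiple of `(u² - v²)(u² - w²)`, a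
quadratic `Q` in `x = u²`, and `F dt / √R = u b(x) du / √Q(x) = b(x) dx / (2 √Q(x))`.

This is elementary because the conic `η² = Q(x)` is rational: the integrand becomes `r(s) ds`, and
the partial fraction decomposition of `r` is a sum of derivatives and of constant multiples of
logarithmic derivatives. -/

noncomputable section

namespace Goursat

section Primitive

universe u

open TrivSqZeroExt in
/-- The ring homomorphism `a ↦ a + D(a) ε` from `A` to the dual numbers over an `A`-algebra `F`.
Derivations are extended to a localization by extending this homomorphism, which avoids the
quotient rule. -/
def dualNumberHom {A : Type*} (F : Type*) [CommRing A] [CommRing F] [Algebra A F]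
    (D : Derivation ℤ A A) : A →+* DualNumber F where
  toFun a := inl (algebraMap A F a) + inr (algebraMap A F (D a))
  map_zero' := by simp
  map_one' := by simp
  map_add' a b := by ext <;> simp [-algebraMap_smul]
  map_mul' a b := by ext <;> simp [-algebraMap_smul, mul_comm]

theorem exists_derivation_extends {A F : Type*} [CommRing A] [CommRing F] [Algebra A F]
    (M : Submonoid A) [IsLocalization M F] (D : Derivation ℤ A A) :
    ∃ D' : Derivation ℤ F F, ∀ a, D' (algebraMap A F a) = algebraMap A F (D a) := by
  have hunit (a : M) : IsUnit (dualNumberHom F D a) := by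
    rw [TrivSqZeroExt.isUnit_iff_isUnit_fst]
    simpa [dualNumberHom] using IsLocalization.map_units F a
  let φ : F →+* DualNumber F := IsLocalization.lift hunit
  have hφ (a : A) : φ (algebraMap A F a) = dualNumberHom F D a := IsLocalization.lift_eq hunit a
  have hfst (f : F) : (φ f).fst = f :=
    RingHom.congr_fun (IsLocalization.ringHom_ext M (RingHom.ext fun a => by
      simp [hφ, dualNumberHom]) :
        ((TrivSqZeroExt.fstHom F F F).toRingHom.comp φ) = RingHom.id F) f
  refine ⟨Derivation.mk' (AddMonoidHom.mk' (fun f => (φ f).snd) fun f g => by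
    rw [map_add, TrivSqZeroExt.snd_add]).toIntLinearMap fun f g => ?_, fun a => ?_⟩
  · simp [hfst, mul_comm]
  · simp [hφ, dualNumberHom, -algebraMap_smul]

theorem exists_adjoin_primitive {K : Type u} [Field K] [Differential K] (d : K) :
    ∃ (L : Type u) (_ : Field L) (_ : Differential L) (_ : Algebra K L)
      (_ : DifferentialAlgebra K L) (θ : L),
      θ′ = algebraMap K L d ∧ IntermediateField.adjoin K {θ} = ⊤ := by
  obtain ⟨D, hD⟩ := exists_derivation_extends (F := RatFunc K) (nonZeroDivisors K[X])
    (Differential.implicitDeriv (Polynomial.C d))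
  let _ : Differential (RatFunc K) := ⟨D⟩
  refine ⟨RatFunc K, inferInstance, inferInstance, inferInstance, ⟨fun a => ?_⟩, RatFunc.X, ?_,
    RatFunc.adjoin_X⟩
  · rw [RatFunc.algebraMap_eq_C, ← RatFunc.algebraMap_C, ← RatFunc.algebraMap_C,
      ← Differential.implicitDeriv_C (Polynomial.C d) a]
    exact hD _
  · rw [RatFunc.algebraMap_eq_C, ← RatFunc.algebraMap_C, ← RatFunc.algebraMap_X,
      ← Differential.implicitDeriv_X (Polynomial.C d)]
    exact hD _

end Primitive

section Liouville

universe u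

open IntermediateField

variable {K M N : Type u} [Field K] [Field M] [Field N] [Differential M] [Differential N]
  [Algebra K M] [Algebra K N] [Algebra M N] [IsScalarTower K M N] [DifferentialAlgebra M N]

theorem IsElementaryGenerator.map {E : IntermediateField K M} {θ : M}
    (h : IsElementaryGenerator E θ) :
    IsElementaryGenerator (E.map (IsScalarTower.toAlgHom K M N)) (algebraMap M N θ) := by
  have hmem {a : M} (ha : a ∈ E) : algebraMap M N a ∈ E.map (IsScalarTower.toAlgHom K M N) :=
    ⟨a, ha, rfl⟩
  obtain halg | ⟨h0, hexp⟩ | ⟨η, hη, h0, hlog⟩ := h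
  · let e := E.equivMap (IsScalarTower.toAlgHom K M N)
    exact .inl (halg.ringHom_of_comp_eq e (algebraMap M N) e.injective (RingHom.ext fun _ => rfl))
  · refine .inr (.inl ⟨by simpa using h0, ?_⟩)
    rw [deriv_algebraMap, ← map_div₀]
    exact hmem hexp
  · refine .inr (.inr ⟨algebraMap M N η, hmem hη, by simpa using h0, ?_⟩)
    rw [deriv_algebraMap, deriv_algebraMap, hlog, map_div₀]

theorem IsElementaryTower.map {E : IntermediateField K M} (h : IsElementaryTower K M E) :
    IsElementaryTower K N (E.map (IsScalarTower.toAlgHom K M N)) := by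
  induction h with
  | base => simpa only [IntermediateField.map_bot] using .base
  | step E θ _ hθ ih =>
    rw [IntermediateField.map_sup, adjoin_map, Set.image_singleton]
    exact .step _ _ ih hθ.map

theorem IsElementaryExtension.adjoin_primitive (h : IsElementaryExtension K M) {v : M} {θ : N}
    (hθ : θ′ = algebraMap M N (Differential.logDeriv v)) (hv : v ≠ 0) (htop : adjoin M {θ} = ⊤) :
    IsElementaryExtension K N := by
  set E := (⊤ : IntermediateField K M).map (IsScalarTower.toAlgHom K M N)
  have hE (a : M) : algebraMap M N a ∈ E := ⟨a, trivial, rfl⟩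
  have hgen : IsElementaryGenerator E θ :=
    .inr (.inr ⟨algebraMap M N v, hE v, by simpa using hv, by
      rw [hθ, deriv_algebraMap, ← map_div₀, Differential.logDeriv]⟩)
  let T : IntermediateField M N := (E ⊔ adjoin K {θ}).toSubfield.toIntermediateField fun a =>
    (le_sup_left : E ≤ E ⊔ adjoin K {θ}) (hE a)
  have hT : ⊤ ≤ T := htop ▸ adjoin_simple_le_iff.2
    ((le_sup_right : adjoin K {θ} ≤ E ⊔ adjoin K {θ}) (mem_adjoin_simple_self K θ))
  have hsup : E ⊔ adjoin K {θ} = ⊤ := top_le_iff.1 fun y _ => hT (x := y) trivial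
  rw [IsElementaryExtension, ← hsup]
  exact .step E θ (IsElementaryTower.map h) hgen

theorem hasElementaryIntegral_zero {K : Type u} [Field K] [CharZero K] [Differential K] :
    HasElementaryIntegral (0 : K) := by
  refine ⟨K, inferInstance, inferInstance, inferInstance, inferInstance, ?_, 0, by simp⟩
  have h : (⊤ : IntermediateField K K) = ⊥ :=
    (bot_eq_top_iff_finrank_eq_one.2 (Module.finrank_self K)).symm
  rw [IsElementaryExtension, h]
  exact .base

variable {K : Type u} [Field K] [CharZero K] [Differential K] {f : K}

theorem HasElementaryIntegral.add_deriv (hf : HasElementaryIntegral f) (w : K) :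
    HasElementaryIntegral (f + w′) := by
  obtain ⟨L, _, _, _, _, hL, g, hg⟩ := hf
  exact ⟨L, _, _, _, ‹_›, hL, g + algebraMap K L w, by rw [map_add, hg, deriv_algebraMap, map_add]⟩

theorem HasElementaryIntegral.add_const_mul_logDeriv (hf : HasElementaryIntegral f) {c : K}
    (hc : c′ = 0) (v : K) : HasElementaryIntegral (f + c * Differential.logDeriv v) := by
  obtain rfl | hv := eq_or_ne v 0
  · simpa using hf
  obtain ⟨L, _, _, _, _, hL, g, hg⟩ := hf
  obtain ⟨N, _, _, _, _, θ, hθ, htop⟩ :=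
    exists_adjoin_primitive (Differential.logDeriv (algebraMap K L v))
  let _ : Algebra K N := ((algebraMap L N).comp (algebraMap K L)).toAlgebra
  have : IsScalarTower K L N := IsScalarTower.of_algebraMap_eq' rfl
  have hderiv (a : K) : (algebraMap K N a)′ = algebraMap K N a′ := by
    simp only [IsScalarTower.algebraMap_apply K L N, deriv_algebraMap]
  refine ⟨N, _, _, _, ⟨hderiv⟩, hL.adjoin_primitive hθ (by simpa using hv) htop,
    algebraMap L N g + algebraMap K N c * θ, ?_⟩
  rw [map_add, Derivation.leibniz, deriv_algebraMap, hderiv, hc, hθ, hg,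
    Differential.logDeriv_algebraMap]
  simp only [map_zero, mul_zero, add_zero, smul_eq_mul, map_add, map_mul,
    IsScalarTower.algebraMap_apply K L N]

/-- Liouville's normal form of an elementary integral: the `k`-combinations of derivatives and
logarithmic derivatives of elements of `K`. -/
def liouvilleSpan (k K : Type*) [Field k] [Field K] [Algebra k K] [Differential K] :
    Submodule k K :=
  Submodule.span k (Set.range (fun w : K => w′) ∪ Set.range Differential.logDeriv)

theorem hasElementaryIntegral_of_mem_liouvilleSpan {k : Type*} [Field k] [Algebra k K]
    (hk : ∀ c : k, (algebraMap k K c)′ = 0) (hf : f ∈ liouvilleSpan k K) :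
    HasElementaryIntegral f := by
  have hsmul (c : k) (w : K) : (c • w)′ = c • w′ := by
    rw [Algebra.smul_def, Algebra.smul_def, Derivation.leibniz, hk, smul_zero, add_zero,
      smul_eq_mul]
  suffices h : ∀ (c : k) (g : K), HasElementaryIntegral g → HasElementaryIntegral (g + c • f) by
    simpa only [zero_add, one_smul] using h 1 0 hasElementaryIntegral_zero
  induction hf using Submodule.span_induction with
  | mem f hf =>
    obtain ⟨w, rfl⟩ | ⟨v, rfl⟩ := hf
    · intro c g hg
      simpa only [hsmul] using hg.add_deriv (c • w)
    · intro c g hg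
      simpa only [Algebra.smul_def] using hg.add_const_mul_logDeriv (hk c) v
  | zero => simp
  | add f₁ f₂ _ _ h₁ h₂ =>
    intro c g hg
    simpa only [smul_add, add_assoc] using h₂ c _ (h₁ c g hg)
  | smul a f _ h =>
    intro c g hg
    simpa only [smul_smul] using h (c * a) g hg

end Liouville

section PartialFractions

open IntermediateField Polynomial

variable {k K : Type*} [Field k] [Field K] [Algebra k K]

/-- The span of the terms `(s - a) ^ m` of partial fraction decompositions in `s`. -/
def simpleFractions (k : Type*) [Field k] [Algebra k K] (s : K) : Submodule k K :=
  Submodule.span k (Set.range fun p : k × ℤ => (s - algebraMap k K p.1) ^ p.2)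

theorem aeval_mem_simpleFractions (s : K) (p : k[X]) : aeval s p ∈ simpleFractions k s := by
  rw [aeval_eq_sum_range]
  exact sum_mem fun n _ => Submodule.smul_mem _ _ (Submodule.subset_span ⟨(0, n), by simp⟩)

theorem aeval_div_mem_simpleFractions {s : K} (hs : ∀ a, s - algebraMap k K a ≠ 0) (p : k[X])
    {q : k[X]} (hq : q.Splits) : aeval s p / aeval s q ∈ simpleFractions k s := by
  classical
  let _ : Algebra k[X] K := (aeval s).toAlgebra
  have hinv : ∀ a ∈ q.roots.toFinset,
      (s - algebraMap k K a)⁻¹ * algebraMap k[X] K (X - C a) = 1 := fun a _ => by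
    simp [RingHom.algebraMap_toAlgebra, hs a]
  obtain ⟨p₀, r, hr, h⟩ := mul_prod_pow_inverse_eq_quo_add_sum_rem_mul_pow_inverse p
    (fun a _ => monic_X_sub_C a) (fun a _ b _ hab => isCoprime_X_sub_C_of_isUnit_sub
      (sub_ne_zero.2 hab).isUnit) (q.roots.count ·) hinv
  have hq' : aeval s p / aeval s q = q.leadingCoeff⁻¹ • (aeval s p *
      ∏ a ∈ q.roots.toFinset, (s - algebraMap k K a)⁻¹ ^ q.roots.count a) := by
    conv_lhs => rw [hq.eq_prod_roots, Finset.prod_multiset_map_count]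
    simp [Algebra.smul_def, map_prod, div_eq_mul_inv, mul_comm, mul_assoc]
  rw [hq']
  refine Submodule.smul_mem _ _ (h ▸ add_mem (aeval_mem_simpleFractions s p₀)
    (sum_mem fun a ha => sum_mem fun j _ => ?_))
  have hconst : r a j = C ((r a j).coeff 0) :=
    eq_C_of_degree_le_zero (Nat.WithBot.lt_one_iff_le_zero.1 (degree_X_sub_C a ▸ hr a ha j))
  rw [hconst, inv_pow, ← zpow_natCast, ← zpow_neg, RingHom.algebraMap_toAlgebra,
    AlgHom.toRingHom_eq_coe, RingHom.coe_coe, aeval_C, ← Algebra.smul_def]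
  exact Submodule.smul_mem _ _ (Submodule.subset_span ⟨(a, _), rfl⟩)

theorem mem_simpleFractions_of_mem_adjoin [IsAlgClosed k] {s : K}
    (hs : ∀ a, s - algebraMap k K a ≠ 0) {g : K} (hg : g ∈ k⟮s⟯) : g ∈ simpleFractions k s := by
  obtain ⟨p, q, rfl⟩ := (mem_adjoin_simple_iff k g).1 hg
  exact aeval_div_mem_simpleFractions hs p (IsAlgClosed.splits q)

variable [Differential K]

theorem mul_deriv_mem_liouvilleSpan [IsAlgClosed k] [CharZero k]
    (hk : ∀ c : k, (algebraMap k K c)′ = 0) {s g : K} (hg : g ∈ k⟮s⟯) :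
    g * s′ ∈ liouvilleSpan k K := by
  by_cases hs' : s′ = 0
  · simp [hs']
  have hs (a : k) : s - algebraMap k K a ≠ 0 := fun h => hs' (by rw [sub_eq_zero.1 h, hk])
  have : CharZero K := charZero_of_injective_algebraMap (algebraMap k K).injective
  replace hg := mem_simpleFractions_of_mem_adjoin hs hg
  induction hg using Submodule.span_induction with
  | mem g hg =>
    obtain ⟨⟨a, m⟩, rfl⟩ := hg
    have hsa : (s - algebraMap k K a)′ = s′ := by rw [map_sub, hk, sub_zero]
    obtain rfl | hm := eq_or_ne m (-1)
    · refine Submodule.subset_span (.inr ⟨s - algebraMap k K a, ?_⟩)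
      simp [Differential.logDeriv, hsa, div_eq_inv_mul]
    · have hm' : (m : K) + 1 ≠ 0 := by exact_mod_cast fun h => hm (eq_neg_of_add_eq_zero_left h)
      have h : (s - algebraMap k K a) ^ m * s′ =
          ((m : k) + 1)⁻¹ • ((s - algebraMap k K a) ^ (m + 1))′ := by
        rw [Algebra.smul_def, Derivation.leibniz_zpow, hsa]
        simp [field]
      exact h ▸ Submodule.smul_mem _ _ (Submodule.subset_span (.inl ⟨_, rfl⟩))
  | zero => simp
  | add f g _ _ hf hg => simpa only [add_mul] using add_mem hf hg
  | smul c f _ hf => simpa only [smul_mul_assoc] using Submodule.smul_mem _ c hf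

theorem exists_deriv_eq_mul_deriv (hk : ∀ c : k, (algebraMap k K c)′ = 0) {s y : K}
    (hy : y ∈ k⟮s⟯) : ∃ r ∈ k⟮s⟯, y′ = r * s′ := by
  induction hy using adjoin_induction with
  | mem y hy => exact ⟨1, one_mem _, by rw [Set.mem_singleton_iff.1 hy, one_mul]⟩
  | algebraMap c => exact ⟨0, zero_mem _, by rw [hk, zero_mul]⟩
  | add y z _ _ hy hz =>
    obtain ⟨⟨r, hr, hy⟩, ⟨t, ht, hz⟩⟩ := hy, hz
    exact ⟨r + t, add_mem hr ht, by rw [map_add, hy, hz, add_mul]⟩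
  | inv y hys hy =>
    obtain ⟨r, hr, hy⟩ := hy
    refine ⟨-(y⁻¹ ^ 2) * r, mul_mem (neg_mem (pow_mem (inv_mem hys) 2)) hr, ?_⟩
    rw [Derivation.leibniz_inv, hy, smul_eq_mul, mul_assoc]
  | mul y z hys hzs hy hz =>
    obtain ⟨⟨r, hr, hy⟩, ⟨t, ht, hz⟩⟩ := hy, hz
    refine ⟨y * t + z * r, add_mem (mul_mem hys ht) (mul_mem hzs hr), ?_⟩
    rw [Derivation.leibniz, hy, hz, smul_eq_mul, smul_eq_mul, add_mul, mul_assoc, mul_assoc]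

end PartialFractions

section Conic

open IntermediateField Polynomial

variable {k K : Type*} [Field k] [Field K] [Algebra k K]

theorem natDegree_C_mul_X_sub_C_mul_X_sub_C {c : k} (hc : c ≠ 0) (a b : k) :
    (C c * ((X - C a) * (X - C b))).natDegree = 2 := by
  rw [natDegree_C_mul hc, natDegree_mul (X_sub_C_ne_zero a) (X_sub_C_ne_zero b),
    natDegree_X_sub_C, natDegree_X_sub_C]

theorem separable_C_mul_X_sub_C_mul_X_sub_C {a b c : k} (hc : c ≠ 0)
    (hab : a ≠ b) : (C c * ((X - C a) * (X - C b))).Separable :=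
  ((separable_X_sub_C.mul separable_X_sub_C (isCoprime_X_sub_C_of_isUnit_sub
    (sub_ne_zero.2 hab).isUnit))).unit_mul (isUnit_C.2 hc.isUnit)

theorem exists_eq_C_mul_X_sub_C_mul_X_sub_C {Q : k[X]} (hQ : Q.Splits) (hdeg : Q.natDegree = 2)
    (hsep : Q.Separable) : ∃ c a b : k, c ≠ 0 ∧ a ≠ b ∧ Q = C c * ((X - C a) * (X - C b)) := by
  obtain ⟨a, b, hab⟩ := Multiset.card_eq_two.1 (hQ.natDegree_eq_card_roots ▸ hdeg)
  have hnodup := nodup_roots hsep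
  rw [hab] at hnodup
  refine ⟨Q.leadingCoeff, a, b, leadingCoeff_ne_zero.2 hsep.ne_zero, by simpa using hnodup, ?_⟩
  simpa [hab] using hQ.eq_prod_roots

/-- The slopes of the lines through the point `(a, 0)` parametrize the conic `η² = Q(x)`. -/
theorem mem_adjoin_slope {a b c : k} (hc : c ≠ 0) (hab : a ≠ b) {x η : K}
    (hxa : x ≠ algebraMap k K a) (hη : η ^ 2 = aeval x (C c * ((X - C a) * (X - C b)))) :
    x ∈ k⟮η / (x - algebraMap k K a)⟯ ∧ η ∈ k⟮η / (x - algebraMap k K a)⟯ := by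
  simp only [map_mul, map_sub, aeval_C, aeval_X] at hη
  set s := η / (x - algebraMap k K a) with hs
  replace hxa := sub_ne_zero.2 hxa
  have hs2 : s ^ 2 * (x - algebraMap k K a) = algebraMap k K c * (x - algebraMap k K b) := by
    rw [hs, div_pow, hη]
    field_simp
  have hsc : s ^ 2 - algebraMap k K c ≠ 0 := fun h => by
    have h2 : algebraMap k K (c * (a - b)) = 0 := by
      rw [map_mul, map_sub]
      linear_combination (x - algebraMap k K a) * h - hs2
    exact mul_ne_zero hc (sub_ne_zero.2 hab) ((map_eq_zero _).1 h2)
  have hx : x =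
      (s ^ 2 * algebraMap k K a - algebraMap k K (c * b)) / (s ^ 2 - algebraMap k K c) := by
    rw [eq_div_iff hsc, map_mul]
    linear_combination hs2
  have hsm : s ^ 2 ∈ k⟮s⟯ := pow_mem (mem_adjoin_simple_self k s) 2
  have hconst (d : k) : algebraMap k K d ∈ k⟮s⟯ := IntermediateField.algebraMap_mem _ d
  have hxm : x ∈ k⟮s⟯ := hx ▸ div_mem (sub_mem (mul_mem hsm (hconst a)) (hconst (c * b)))
    (sub_mem hsm (hconst c))
  refine ⟨hxm, ?_⟩
  rw [← div_mul_cancel₀ η hxa]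
  exact mul_mem (mem_adjoin_simple_self k s) (sub_mem hxm (hconst a))

theorem mul_deriv_mem_liouvilleSpan_of_sq_eq [IsAlgClosed k] [CharZero k] [Differential K]
    (hk : ∀ c : k, (algebraMap k K c)′ = 0) {Q : k[X]} (hdeg : Q.natDegree = 2)
    (hsep : Q.Separable) {x η f : K} (hη : η ^ 2 = aeval x Q) (hf : f ∈ k⟮x, η⟯) :
    f * x′ ∈ liouvilleSpan k K := by
  obtain ⟨c, a, b, hc, hab, rfl⟩ := exists_eq_C_mul_X_sub_C_mul_X_sub_C (IsAlgClosed.splits Q)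
    hdeg hsep
  obtain rfl | hxa := eq_or_ne x (algebraMap k K a)
  · simp [hk]
  obtain ⟨hx, hηs⟩ := mem_adjoin_slope hc hab hxa hη
  set s := η / (x - algebraMap k K a)
  have hle : k⟮x, η⟯ ≤ k⟮s⟯ := adjoin_le_iff.2 (Set.pair_subset hx hηs)
  obtain ⟨r, hr, hxr⟩ := exists_deriv_eq_mul_deriv hk hx
  rw [hxr, ← mul_assoc]
  exact mul_deriv_mem_liouvilleSpan hk (mul_mem (hle hf) hr)

end Conic

section Bracket

open Matrix

variable {A B : Type*} [CommRing A] [CommRing B]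

/-- The bracket `[v, w]`, the determinant of the matrix with columns `v` and `w`. -/
def bracket (v w : Fin 2 → A) : A := v 0 * w 1 - v 1 * w 0

theorem bracket_self (v : Fin 2 → A) : bracket v v = 0 := by
  rw [bracket, mul_comm, sub_self]

theorem bracket_smul_left (c : A) (v w : Fin 2 → A) : bracket (c • v) w = c * bracket v w := by
  simp only [bracket, Pi.smul_apply, smul_eq_mul]
  ring

theorem bracket_smul_right (c : A) (v w : Fin 2 → A) : bracket v (c • w) = c * bracket v w := by
  simp only [bracket, Pi.smul_apply, smul_eq_mul]
  ring

theorem bracket_mulVec_mulVec (M : Matrix (Fin 2) (Fin 2) A) (v w : Fin 2 → A) :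
    bracket (M *ᵥ v) (M *ᵥ w) = M.det * bracket v w := by
  simp only [bracket, mulVec, dotProduct, det_fin_two, Fin.sum_univ_two]
  ring

theorem bracket_mulVec_add_bracket_mulVec (M : Matrix (Fin 2) (Fin 2) A) (v w : Fin 2 → A) :
    bracket (M *ᵥ v) w + bracket v (M *ᵥ w) = M.trace * bracket v w := by
  simp only [bracket, mulVec, dotProduct, trace_fin_two, Fin.sum_univ_two]
  ring

theorem bracket_mulVec_left {M : Matrix (Fin 2) (Fin 2) A} (hM : M.trace = 0) (v w : Fin 2 → A) :
    bracket (M *ᵥ v) w = -bracket v (M *ᵥ w) :=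
  eq_neg_of_add_eq_zero_left (by rw [bracket_mulVec_add_bracket_mulVec, hM, zero_mul])

theorem add_mul_bracket_eq_zero {M : Matrix (Fin 2) (Fin 2) A} (hM : M.trace = 0) {k m : A}
    {v w : Fin 2 → A} (hv : M *ᵥ v = k • v) (hw : M *ᵥ w = m • w) : (k + m) * bracket v w = 0 := by
  have h := bracket_mulVec_left hM v w
  rw [hv, hw, bracket_smul_left, bracket_smul_right] at h
  linear_combination h

theorem bracket_mul_bracket (v w a b : Fin 2 → A) :
    bracket v w * bracket a b = bracket v a * bracket w b - bracket v b * bracket w a := by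
  simp only [bracket]
  ring

theorem map_bracket (φ : A →+* B) (v w : Fin 2 → A) :
    φ (bracket v w) = bracket (φ ∘ v) (φ ∘ w) := by
  simp only [bracket, map_sub, map_mul, Function.comp_apply]

theorem map_mulVec_comp_of_mulVec_eq_smul (φ : A →+* B) {M : Matrix (Fin 2) (Fin 2) A}
    {v w : Fin 2 → A} {c : A} (h : M *ᵥ v = c • w) :
    M.map φ *ᵥ (φ ∘ v) = φ c • (φ ∘ w) := by
  funext i
  rw [← RingHom.map_mulVec, h]
  exact map_mul φ c (w i)

end Bracket

section BracketRatio

open Matrix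

variable {K L : Type*} [Field K] [Field L] {a b : Fin 2 → K}

/-- The coordinate on the projective line that vanishes at `a` and has its pole at `b`. -/
def bracketRatio (a b v : Fin 2 → K) : K := bracket v a / bracket v b

theorem bracketRatio_smul {c : K} (hc : c ≠ 0) (a b v : Fin 2 → K) :
    bracketRatio a b (c • v) = bracketRatio a b v := by
  rw [bracketRatio, bracket_smul_left, bracket_smul_left, mul_div_mul_left _ _ hc, bracketRatio]

theorem map_bracketRatio (φ : K →+* L) (a b v : Fin 2 → K) :
    φ (bracketRatio a b v) = bracketRatio (φ ∘ a) (φ ∘ b) (φ ∘ v) := by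
  rw [bracketRatio, map_div₀, map_bracket, map_bracket, bracketRatio]

theorem bracketRatio_mulVec {M : Matrix (Fin 2) (Fin 2) K} (hM : M.trace = 0) {k : K} (hk : k ≠ 0)
    (ha : M *ᵥ a = k • a) (hb : M *ᵥ b = -k • b) (v : Fin 2 → K) :
    bracketRatio a b (M *ᵥ v) = -bracketRatio a b v := by
  rw [bracketRatio, bracket_mulVec_left hM, bracket_mulVec_left hM, ha, hb, bracket_smul_right,
    bracket_smul_right, neg_mul, neg_neg, neg_div, mul_div_mul_left _ _ hk, bracketRatio]

theorem bracket_mul_bracket_eq_bracketRatio_sub {v w : Fin 2 → K} (hv : bracket v b ≠ 0)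
    (hw : bracket w b ≠ 0) : bracket v w * bracket a b =
      bracket v b * bracket w b * (bracketRatio a b v - bracketRatio a b w) := by
  rw [bracket_mul_bracket, bracketRatio, bracketRatio]
  field_simp

end BracketRatio

section HomCoord

open Matrix

variable {K : Type*} [Field K]

/-- Homogeneous coordinates of a point of the projective line. The sign at `∞` is chosen such that
`linFactor z` is the bracket of `(t, 1)` with the coordinates of `z`. -/
def homCoord : OnePoint K → Fin 2 → K
  | ∞ => ![-1, 0]
  | (a : K) => ![a, 1]

@[simp] theorem homCoord_infty : homCoord (∞ : OnePoint K) = ![-1, 0] := rfl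

@[simp] theorem homCoord_coe (a : K) : homCoord (a : OnePoint K) = ![a, 1] := rfl

theorem homCoord_ne_zero (z : OnePoint K) : homCoord z ≠ 0 := by
  induction z using OnePoint.rec <;> simp

theorem bracket_homCoord_eq_zero_iff {z w : OnePoint K} :
    bracket (homCoord z) (homCoord w) = 0 ↔ z = w := by
  induction z using OnePoint.rec <;> induction w using OnePoint.rec <;>
    simp [bracket, sub_eq_zero]

theorem equivProjectivization_eq_mk_homCoord [DecidableEq K] (z : OnePoint K) :
    OnePoint.equivProjectivization K z = .mk K (homCoord z) (homCoord_ne_zero z) := by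
  induction z using OnePoint.rec with
  | infty =>
    rw [OnePoint.equivProjectivization_apply_infinity, Projectivization.mk_eq_mk_iff']
    exact ⟨-1, by simp⟩
  | coe a => rfl

theorem exists_eq_smul_homCoord {v : Fin 2 → K} (hv : v ≠ 0) :
    ∃ (z : OnePoint K) (c : Kˣ), v = c • homCoord z := by
  classical
  obtain ⟨z, hz⟩ := (OnePoint.equivProjectivization K).surjective (.mk K v hv)
  rw [equivProjectivization_eq_mk_homCoord, eq_comm, Projectivization.mk_eq_mk_iff] at hz
  exact ⟨z, hz.imp fun _ => Eq.symm⟩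

variable [DecidableEq K]

theorem exists_mulVec_homCoord (S : GL (Fin 2) K) (z : OnePoint K) :
    ∃ c : Kˣ, S.1 *ᵥ homCoord z = c • homCoord (S • z) := by
  have h := OnePoint.equivProjectivization_smul (g := S) z
  rw [equivProjectivization_eq_mk_homCoord, equivProjectivization_eq_mk_homCoord,
    Projectivization.smul_mk, eq_comm, Projectivization.mk_eq_mk_iff] at h
  exact h.imp fun c hc => hc.symm

theorem smul_eq_iff {S : GL (Fin 2) K} {z w : OnePoint K} :
    S • z = w ↔ bracket (S.1 *ᵥ homCoord z) (homCoord w) = 0 := by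
  obtain ⟨c, h⟩ := exists_mulVec_homCoord S z
  rw [h, Units.smul_def, bracket_smul_left, Units.mul_right_eq_zero, bracket_homCoord_eq_zero_iff]

theorem smul_eq_self_of_mulVec_eq_smul {S : GL (Fin 2) K} {z : OnePoint K} {k : K}
    (h : S.1 *ᵥ homCoord z = k • homCoord z) : S • z = z := by
  rw [smul_eq_iff, h, bracket_smul_left, bracket_self, mul_zero]

theorem smul_eq_comm {S : GL (Fin 2) K} (hS : S.1.trace = 0) {z w : OnePoint K} :
    S • z = w ↔ S • w = z := by
  rw [smul_eq_iff, smul_eq_iff, bracket_mulVec_left hS, neg_eq_zero, bracket, bracket,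
    ← neg_eq_zero, neg_sub, mul_comm, mul_comm (homCoord z 0)]

theorem exists_eigenvalue_of_smul_eq_self {S : GL (Fin 2) K} (hS : S.1.trace = 0) {α β : OnePoint K}
    (hαβ : α ≠ β) (hα : S • α = α) (hβ : S • β = β) :
    ∃ k : K, k ≠ 0 ∧ S.1 *ᵥ homCoord α = k • homCoord α ∧ S.1 *ᵥ homCoord β = -k • homCoord β := by
  obtain ⟨k, hαk⟩ := exists_mulVec_homCoord S α
  obtain ⟨m, hβm⟩ := exists_mulVec_homCoord S β
  rw [hα, Units.smul_def] at hαk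
  rw [hβ, Units.smul_def] at hβm
  have hkm := (mul_eq_zero.1 (add_mul_bracket_eq_zero hS hαk hβm)).resolve_right
    (mt bracket_homCoord_eq_zero_iff.1 hαβ)
  exact ⟨k, k.ne_zero, hαk, eq_neg_of_add_eq_zero_right hkm ▸ hβm⟩

end HomCoord

section Involution

open Matrix

theorem sq_add_det_smul_one {A : Type*} [CommRing A] [Nontrivial A]
    (M : Matrix (Fin 2) (Fin 2) A) :
    M ^ 2 + M.det • (1 : Matrix (Fin 2) (Fin 2) A) = M.trace • M := by
  have h := M.aeval_self_charpoly
  simp only [charpoly_fin_two, map_add, map_sub, map_mul, map_pow, Polynomial.aeval_X,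
    Polynomial.aeval_C, ← Algebra.smul_def] at h
  rwa [sub_add_eq_add_sub, sub_eq_zero, Algebra.algebraMap_eq_smul_one] at h

theorem exists_mulVec_eq_smul {n A : Type*} [Fintype n] [DecidableEq n] [CommRing A]
    {M : Matrix n n A} {k : A} (hM : M ^ 2 = k ^ 2 • 1) (hne : M ≠ -k • 1) :
    ∃ v : n → A, v ≠ 0 ∧ M *ᵥ v = k • v := by
  have hfactor : M * (M + k • 1) = k • (M + k • 1) := by
    rw [mul_add, ← pow_two, hM, mul_smul_comm, mul_one, smul_add, smul_smul, pow_two, add_comm]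
  obtain ⟨w, hw⟩ : ∃ w, (M + k • 1) *ᵥ w ≠ 0 := by
    by_contra! h
    exact hne (by
      rw [neg_smul]
      exact eq_neg_of_add_eq_zero_left (mulVec_injective (by ext1 w; rw [h, zero_mulVec])))
  exact ⟨_, hw, by rw [mulVec_mulVec, hfactor, smul_mulVec]⟩

variable {K : Type*} [Field K]

theorem trace_eq_zero_of_sq_mem_center {S : GL (Fin 2) K}
    (h2 : S ^ 2 ∈ Subgroup.center (GL (Fin 2) K)) (h1 : S ∉ Subgroup.center (GL (Fin 2) K)) :
    S.1.trace = 0 := by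
  rw [GeneralLinearGroup.mem_center_iff_val_mem_range_scalar] at h1 h2
  obtain ⟨c, hc⟩ := h2
  by_contra htr
  refine h1 ⟨S.1.trace⁻¹ * (c + S.1.det), ?_⟩
  rw [scalar_apply, ← smul_one_eq_diagonal] at hc ⊢
  rw [mul_smul, inv_smul_eq_iff₀ htr, ← sq_add_det_smul_one, add_smul, hc, Units.val_pow_eq_pow_val]

theorem ne_of_mulVec_eq_smul [NeZero (2 : K)] {M : Matrix (Fin 2) (Fin 2) K} {k : K} (hk : k ≠ 0)
    {α β : OnePoint K} (hα : M *ᵥ homCoord α = k • homCoord α)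
    (hβ : M *ᵥ homCoord β = -k • homCoord β) : α ≠ β := by
  rintro rfl
  have h : (2 * k) • homCoord α = 0 := by
    rw [two_mul, add_smul, eq_neg_iff_add_eq_zero.1 (neg_smul k (homCoord α) ▸ hα.symm.trans hβ)]
  exact smul_ne_zero (mul_ne_zero two_ne_zero hk) (homCoord_ne_zero α) h

variable [DecidableEq K]

theorem setOf_smul_eq_self [NeZero (2 : K)] {S : GL (Fin 2) K} (hS : S.1.trace = 0) {k : K}
    (hk : k ≠ 0) {α β : OnePoint K} (hα : S.1 *ᵥ homCoord α = k • homCoord α)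
    (hβ : S.1 *ᵥ homCoord β = -k • homCoord β) : {z : OnePoint K | S • z = z} = {α, β} := by
  ext z
  refine ⟨fun (hz : S • z = z) => ?_, ?_⟩
  · obtain ⟨m, hm⟩ := exists_mulVec_homCoord S z
    rw [hz, Units.smul_def] at hm
    have h1 := add_mul_bracket_eq_zero hS hm hα
    have h2 := add_mul_bracket_eq_zero hS hm hβ
    rw [mul_eq_zero, bracket_homCoord_eq_zero_iff] at h1 h2
    refine or_iff_not_and_not.2 fun ⟨hzα, hzβ⟩ => mul_ne_zero two_ne_zero hk ?_
    linear_combination h1.resolve_right hzα - h2.resolve_right hzβ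
  · rintro (rfl | rfl)
    exacts [smul_eq_self_of_mulVec_eq_smul hα, smul_eq_self_of_mulVec_eq_smul hβ]

theorem exists_setOf_smul_eq_self [IsAlgClosed K] [NeZero (2 : K)] {S : GL (Fin 2) K}
    (hS : S.1.trace = 0) :
    ∃ α β : OnePoint K, α ≠ β ∧ {z : OnePoint K | S • z = z} = {α, β} := by
  obtain ⟨k, hk⟩ := IsAlgClosed.exists_pow_nat_eq (-S.1.det) two_pos
  have hk0 : k ≠ 0 := fun h => S.det_ne_zero (by simpa [h] using hk)
  have hfixed (m : K) (hm : m ^ 2 = -S.1.det) (hm0 : m ≠ 0) :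
      ∃ z : OnePoint K, S.1 *ᵥ homCoord z = m • homCoord z := by
    have hsq : S.1 ^ 2 = m ^ 2 • 1 := by
      rw [hm, neg_smul, eq_neg_iff_add_eq_zero, sq_add_det_smul_one, hS, zero_smul]
    obtain ⟨v, hv, hSv⟩ := exists_mulVec_eq_smul hsq fun h => by simp [h, two_ne_zero, hm0] at hS
    obtain ⟨z, c, rfl⟩ := exists_eq_smul_homCoord hv
    exact ⟨z, smul_left_cancel c (by rw [← mulVec_smul, hSv, smul_comm])⟩
  obtain ⟨α, hα⟩ := hfixed k hk hk0
  obtain ⟨β, hβ⟩ := hfixed (-k) (by rw [neg_sq, hk]) (neg_ne_zero.2 hk0)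
  exact ⟨α, β, ne_of_mulVec_eq_smul hk0 hα hβ, setOf_smul_eq_self hS hk0 hα hβ⟩

end Involution

section FixCoord

open Matrix IntermediateField

/-- The generic point `(t, 1)` of the projective line. -/
def genericPoint : Fin 2 → RatFunc ℂ := ![RatFunc.X, 1]

theorem linFactor_eq_bracket (z : OnePoint ℂ) :
    linFactor z = bracket genericPoint (RatFunc.C ∘ homCoord z) := by
  induction z using OnePoint.rec with
  | infty => simp [linFactor, bracket, genericPoint]
  | coe a => simp [linFactor, bracket, genericPoint]

theorem fixCoord_eq_bracketRatio (α β : OnePoint ℂ) : fixCoord α β =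
    bracketRatio (RatFunc.C ∘ homCoord α) (RatFunc.C ∘ homCoord β) genericPoint := by
  rw [fixCoord, linFactor_eq_bracket, linFactor_eq_bracket, bracketRatio]

theorem linFactor_ne_zero (z : OnePoint ℂ) : linFactor z ≠ 0 := by
  induction z using OnePoint.rec with
  | infty => exact one_ne_zero
  | coe a =>
    change RatFunc.X - RatFunc.C a ≠ 0
    rw [← RatFunc.algebraMap_X, ← RatFunc.algebraMap_C, ← map_sub]
    exact RatFunc.algebraMap_ne_zero (Polynomial.X_sub_C_ne_zero a)

/-- The value of `fixCoord α β` at `z`, for `z ≠ β`. -/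
def fixCoordAt (α β z : OnePoint ℂ) : ℂ := bracketRatio (homCoord α) (homCoord β) (homCoord z)

theorem exists_linFactor_eq {α β z : OnePoint ℂ} (hαβ : α ≠ β) (hz : z ≠ β) :
    ∃ c : ℂ, c ≠ 0 ∧
      linFactor z = RatFunc.C c * linFactor β * (fixCoord α β - RatFunc.C (fixCoordAt α β z)) := by
  have hαβ' : RatFunc.C (bracket (homCoord α) (homCoord β)) ≠ 0 :=
    (map_ne_zero _).2 (mt bracket_homCoord_eq_zero_iff.1 hαβ)
  have hz' := mt bracket_homCoord_eq_zero_iff.1 hz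
  refine ⟨_, div_ne_zero hz' (mt bracket_homCoord_eq_zero_iff.1 hαβ), ?_⟩
  have hβ := linFactor_ne_zero β
  have h := bracket_mul_bracket_eq_bracketRatio_sub (a := RatFunc.C ∘ homCoord α)
    (linFactor_eq_bracket β ▸ hβ) (w := RatFunc.C ∘ homCoord z)
    (by rwa [← map_bracket, map_ne_zero])
  simp only [← linFactor_eq_bracket, ← fixCoord_eq_bracketRatio, ← map_bracket, ← map_bracketRatio]
    at h
  rw [eq_div_of_mul_eq hαβ' h, map_div₀, fixCoordAt]
  ring

theorem fixCoordAt_injOn {α β : OnePoint ℂ} (hαβ : α ≠ β) : Set.InjOn (fixCoordAt α β) {β}ᶜ := by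
  intro z hz w hw h
  have h := bracket_mul_bracket_eq_bracketRatio_sub (a := homCoord α)
    (mt bracket_homCoord_eq_zero_iff.1 hz) (mt bracket_homCoord_eq_zero_iff.1 hw)
  rw [← fixCoordAt, ← fixCoordAt, ‹fixCoordAt α β z = _›, sub_self, mul_zero, mul_eq_zero,
    bracket_homCoord_eq_zero_iff, bracket_homCoord_eq_zero_iff] at h
  exact h.resolve_right hαβ

theorem fixCoordAt_smul {S : GL (Fin 2) ℂ} (hS : S.1.trace = 0) {α β : OnePoint ℂ} (hαβ : α ≠ β)
    (hα : S • α = α) (hβ : S • β = β) (z : OnePoint ℂ) :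
    fixCoordAt α β (S • z) = -fixCoordAt α β z := by
  obtain ⟨k, hk, hαk, hβk⟩ := exists_eigenvalue_of_smul_eq_self hS hαβ hα hβ
  obtain ⟨c, hc⟩ := exists_mulVec_homCoord S z
  rw [fixCoordAt, fixCoordAt, ← bracketRatio_mulVec hS hk hαk hβk, hc, Units.smul_def,
    bracketRatio_smul c.ne_zero]

theorem exists_linFactor_mul_linFactor_smul {S : GL (Fin 2) ℂ} (hS : S.1.trace = 0)
    {α β : OnePoint ℂ} (hαβ : α ≠ β) (hα : S • α = α) (hβ : S • β = β) {z : OnePoint ℂ}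
    (hz : z ≠ β) :
    ∃ c : ℂ, c ≠ 0 ∧ linFactor z * linFactor (S • z) = RatFunc.C c * linFactor β ^ 2 *
      (fixCoord α β ^ 2 - RatFunc.C (fixCoordAt α β z ^ 2)) := by
  obtain ⟨c, hc, hcz⟩ := exists_linFactor_eq hαβ hz
  obtain ⟨d, hd, hdz⟩ := exists_linFactor_eq hαβ (mt (smul_eq_comm hS).1 (hβ.trans_ne hz.symm))
  refine ⟨c * d, mul_ne_zero hc hd, ?_⟩
  rw [hcz, hdz, fixCoordAt_smul hS hαβ hα hβ, map_neg, map_mul, map_pow]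
  ring

theorem fixCoordAt_sq_ne {S : GL (Fin 2) ℂ} (hS : S.1.trace = 0) {α β : OnePoint ℂ} (hαβ : α ≠ β)
    (hα : S • α = α) (hβ : S • β = β) {z w : OnePoint ℂ} (hz : z ≠ β) (hw : w ≠ β)
    (hwz : w ≠ z) (hwSz : w ≠ S • z) : fixCoordAt α β z ^ 2 ≠ fixCoordAt α β w ^ 2 := by
  rw [Ne, sq_eq_sq_iff_eq_or_eq_neg, ← fixCoordAt_smul hS hαβ hα hβ, not_or]
  exact ⟨fun h => hwz (fixCoordAt_injOn hαβ hz hw h).symm, fun h => hwSz ((smul_eq_comm hS).1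
    (fixCoordAt_injOn hαβ hz (mt (smul_eq_comm hS).1 (hβ.trans_ne hw.symm)) h).symm).symm⟩

theorem deriv_sq {K : Type*} [Field K] [Differential K] (a : K) : (a ^ 2)′ = 2 * a * a′ := by
  rw [pow_two, Derivation.leibniz, smul_eq_mul, ← two_mul, mul_assoc]

theorem deriv_div_mul_sq {K : Type*} [Field K] [Differential K] (a : K) {b : K} (hb : b ≠ 0) :
    (a / b)′ * b ^ 2 = b * a′ - a * b′ := by
  rw [Derivation.leibniz_div, smul_eq_mul, smul_eq_mul, smul_eq_mul, mul_comm, inv_pow,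
    mul_inv_cancel_left₀ (pow_ne_zero 2 hb)]

theorem deriv_C (c : ℂ) : (RatFunc.C c : RatFunc ℂ)′ = 0 := by
  have h := ratDeriv_div (Polynomial.C c) 1 one_ne_zero
  change ratDeriv _ = 0
  simpa using h

theorem deriv_X : (RatFunc.X : RatFunc ℂ)′ = 1 := by
  have h := ratDeriv_div Polynomial.X 1 one_ne_zero
  change ratDeriv _ = 1
  simpa using h

theorem deriv_linFactor (z : OnePoint ℂ) : (linFactor z)′ = RatFunc.C (homCoord z 1) := by
  simp [linFactor_eq_bracket, bracket, genericPoint, deriv_C, deriv_X]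

theorem deriv_fixCoord_mul_linFactor_sq (α β : OnePoint ℂ) : (fixCoord α β)′ * linFactor β ^ 2 =
    RatFunc.C (bracket (homCoord α) (homCoord β)) := by
  rw [fixCoord, deriv_div_mul_sq _ (linFactor_ne_zero β), deriv_linFactor, deriv_linFactor]
  simp only [linFactor_eq_bracket, bracket, genericPoint, Matrix.cons_val_zero,
    Matrix.cons_val_one, Function.comp_apply, one_mul, map_sub, map_mul]
  ring

theorem deriv_fixCoord_ne_zero {α β : OnePoint ℂ} (hαβ : α ≠ β) : (fixCoord α β)′ ≠ 0 := by
  refine left_ne_zero_of_mul (b := linFactor β ^ 2) ?_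
  rw [deriv_fixCoord_mul_linFactor_sq, map_ne_zero]
  exact mt bracket_homCoord_eq_zero_iff.1 hαβ

theorem adjoin_fixCoord {α β : OnePoint ℂ} (hαβ : α ≠ β) : adjoin ℂ {fixCoord α β} = ⊤ := by
  rw [eq_top_iff, ← RatFunc.adjoin_X, adjoin_simple_le_iff]
  set u := fixCoord α β
  have hC (c : ℂ) : RatFunc.C c ∈ adjoin ℂ {u} := IntermediateField.algebraMap_mem _ c
  have hX : RatFunc.X * (u * RatFunc.C (homCoord β 1) - RatFunc.C (homCoord α 1)) =
      u * RatFunc.C (homCoord β 0) - RatFunc.C (homCoord α 0) := by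
    have h : u * linFactor β = linFactor α := div_mul_cancel₀ _ (linFactor_ne_zero β)
    simp only [linFactor_eq_bracket, bracket, genericPoint, cons_val_zero, cons_val_one,
      Function.comp_apply] at h
    linear_combination h
  have h0 : u * RatFunc.C (homCoord β 1) - RatFunc.C (homCoord α 1) ≠ 0 := fun h0 => by
    refine hαβ (bracket_homCoord_eq_zero_iff.1 ((map_eq_zero RatFunc.C).1 ?_))
    rw [h0, mul_zero] at hX
    simp only [bracket, map_sub, map_mul]
    linear_combination RatFunc.C (homCoord β 1) * hX + RatFunc.C (homCoord β 0) * h0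
  rw [eq_div_of_mul_eq h0 hX]
  have hmem : u ∈ adjoin ℂ {u} := mem_adjoin_simple_self ℂ u
  exact div_mem (sub_mem (mul_mem hmem (hC _)) (hC _)) (sub_mem (mul_mem hmem (hC _)) (hC _))

end FixCoord

section Roots

theorem exists_prod_eq_of_card_eq_four {ι : Type*} {P : Finset ι} (hP : P.card = 4) {f : ι → ι}
    (hmem : ∀ z ∈ P, f z ∈ P) (hne : ∀ z ∈ P, f z ≠ z) (hf : Function.Involutive f) :
    ∃ z ∈ P, ∃ w ∈ P, w ≠ z ∧ w ≠ f z ∧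
      ∀ {M : Type*} [CommMonoid M] (g : ι → M), ∏ x ∈ P, g x = g z * g (f z) * (g w * g (f w)) := by
  classical
  obtain ⟨z, hz⟩ : P.Nonempty := Finset.card_pos.1 (by omega)
  obtain ⟨w, hw, hwz⟩ : ∃ w ∈ P, w ∉ ({z, f z} : Finset ι) :=
    Finset.exists_mem_notMem_of_card_lt_card (Finset.card_le_two.trans_lt (by omega))
  simp only [Finset.mem_insert, Finset.mem_singleton, not_or] at hwz
  have hnodup : [z, f z, w, f w].Nodup := by
    have h1 : z ≠ f w := fun h => hwz.2 (hf.eq_iff.1 h.symm)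
    have h2 : f z ≠ f w := fun h => hwz.1 (hf.injective h).symm
    simp [(hne z hz).symm, (hne w hw).symm, Ne.symm hwz.1, Ne.symm hwz.2, h1, h2]
  have hsub : [z, f z, w, f w].toFinset ⊆ P := by
    simp [Finset.insert_subset_iff, hz, hw, hmem z hz, hmem w hw]
  have heq := Finset.eq_of_subset_of_card_le hsub (by
    rw [hP, List.toFinset_card_of_nodup hnodup]
    rfl)
  refine ⟨z, hz, w, hw, hwz.1, hwz.2, fun g => ?_⟩
  rw [← heq, List.prod_toFinset g hnodup]
  simp [mul_assoc]

theorem linFactor_infty : linFactor ∞ = 1 := rfl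

theorem linFactor_coe (a : ℂ) : linFactor a = RatFunc.X - RatFunc.C a := rfl

/-- The set `projRoots R`, for `R ≠ 0`, as a finset. -/
def projRootFinset (R : ℂ[X]) : Finset (OnePoint ℂ) :=
  (R.roots.toFinset.map ⟨(↑), OnePoint.coe_injective⟩).disjUnion
    (if R.natDegree = 3 then {∞} else ∅) (by split_ifs <;> simp)

theorem mem_projRootFinset {R : ℂ[X]} (hR : R ≠ 0) {z : OnePoint ℂ} :
    z ∈ projRootFinset R ↔ z ∈ projRoots R := by
  by_cases h : R.natDegree = 3 <;>
    simp [projRootFinset, projRoots, hR, h, and_comm, eq_comm, or_comm]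

theorem card_projRootFinset {R : ℂ[X]} (hdeg : R.natDegree = 3 ∨ R.natDegree = 4)
    (hR : R.Separable) : (projRootFinset R).card = 4 := by
  rw [projRootFinset, Finset.card_disjUnion, Finset.card_map,
    Multiset.toFinset_card_of_nodup (Polynomial.nodup_roots hR),
    ← (IsAlgClosed.splits R).natDegree_eq_card_roots]
  rcases hdeg with h | h <;> simp [h]

theorem algebraMap_eq_C_mul_prod_linFactor {R : ℂ[X]} (hR : R.Separable) :
    algebraMap ℂ[X] (RatFunc ℂ) R =
      RatFunc.C R.leadingCoeff * ∏ z ∈ projRootFinset R, linFactor z := by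
  have hinfty : ∏ z ∈ if R.natDegree = 3 then {∞} else ∅, linFactor z = 1 := by
    split_ifs <;> simp [linFactor_infty]
  conv_lhs => rw [(IsAlgClosed.splits R).eq_prod_roots,
    ← Multiset.dedup_eq_self.2 (Polynomial.nodup_roots hR)]
  rw [projRootFinset, Finset.prod_disjUnion, hinfty, mul_one, Finset.prod_map]
  simp [linFactor_coe, map_multiset_prod, Finset.prod, Function.comp_def]

end Roots

section Quadratic

open Polynomial

theorem exists_quadratic {R : ℂ[X]} (hdeg : R.natDegree = 3 ∨ R.natDegree = 4) (hR : R.Separable)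
    {S : GL (Fin 2) ℂ} (hS : S.1.trace = 0) (hSR : PermutesInPairs S R) {α β : OnePoint ℂ}
    (hαβ : α ≠ β) (hα : S • α = α) (hβ : S • β = β) :
    ∃ Q : ℂ[X], Q.natDegree = 2 ∧ Q.Separable ∧
      (fixCoord α β)′ ^ 2 * algebraMap ℂ[X] (RatFunc ℂ) R = aeval (fixCoord α β ^ 2) Q := by
  obtain ⟨z, hz, w, hw, hwz, hwSz, hprod⟩ := exists_prod_eq_of_card_eq_four
    (card_projRootFinset hdeg hR) (f := (S • ·))
    (by simpa only [mem_projRootFinset hR.ne_zero] using fun z hz => (hSR z hz).1)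
    (by simpa only [mem_projRootFinset hR.ne_zero] using fun z hz => (hSR z hz).2)
    (fun z => (smul_eq_comm hS).1 rfl)
  rw [mem_projRootFinset hR.ne_zero] at hz hw
  have hzβ : z ≠ β := fun h => (hSR z hz).2 (h ▸ hβ)
  have hwβ : w ≠ β := fun h => (hSR w hw).2 (h ▸ hβ)
  obtain ⟨c, hc, hcz⟩ := exists_linFactor_mul_linFactor_smul hS hαβ hα hβ hzβ
  obtain ⟨d, hd, hdw⟩ := exists_linFactor_mul_linFactor_smul hS hαβ hα hβ hwβ
  have he : bracket (homCoord α) (homCoord β) ≠ 0 := mt bracket_homCoord_eq_zero_iff.1 hαβ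
  set e := bracket (homCoord α) (homCoord β)
  have hm : e ^ 2 * R.leadingCoeff * c * d ≠ 0 :=
    mul_ne_zero (mul_ne_zero (mul_ne_zero (pow_ne_zero 2 he)
      (leadingCoeff_ne_zero.2 hR.ne_zero)) hc) hd
  refine ⟨_, natDegree_C_mul_X_sub_C_mul_X_sub_C hm _ _, separable_C_mul_X_sub_C_mul_X_sub_C hm
    (fixCoordAt_sq_ne hS hαβ hα hβ hzβ hwβ hwz hwSz), ?_⟩
  rw [algebraMap_eq_C_mul_prod_linFactor hR, hprod, hcz, hdw]
  simp only [map_mul, map_sub, map_pow, aeval_C, aeval_X, RatFunc.algebraMap_eq_C]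
  rw [← deriv_fixCoord_mul_linFactor_sq]
  ring

end Quadratic

section OddPart

open IntermediateField Polynomial

variable {k K : Type*} [Field k] [Field K] [Algebra k K]

theorem exists_add_mul_of_mem_adjoin {u F : K} (hF : F ∈ k⟮u⟯) :
    ∃ a ∈ k⟮u ^ 2⟯, ∃ b ∈ k⟮u ^ 2⟯, F = a + b * u := by
  let E := k⟮u ^ 2⟯
  let r : E := ⟨u ^ 2, mem_adjoin_simple_self k _⟩
  have hmonic : (X ^ 2 - C r).Monic := monic_X_pow_sub_C r two_ne_zero
  have hroot : aeval u (X ^ 2 - C r) = 0 := by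
    rw [map_sub, map_pow, aeval_X, aeval_C, sub_eq_zero]
    rfl
  have hle : k⟮u⟯ ≤ E⟮u⟯.restrictScalars k := adjoin_simple_le_iff.2 (mem_adjoin_simple_self E u)
  have hF' : F ∈ E⟮u⟯.toSubalgebra := hle hF
  rw [adjoin_simple_toSubalgebra_of_isAlgebraic ⟨_, hmonic.ne_zero, hroot⟩,
    Algebra.adjoin_singleton_eq_range_aeval] at hF'
  obtain ⟨p, rfl⟩ := hF'
  have hdeg : (p %ₘ (X ^ 2 - C r)).natDegree < 2 := by
    have h := natDegree_modByMonic_lt p hmonic fun h => two_ne_zero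
      ((natDegree_X_pow_sub_C (n := 2) (r := r)).symm.trans (h ▸ natDegree_one))
    rwa [natDegree_X_pow_sub_C] at h
  obtain ⟨b, a, hab⟩ := exists_eq_X_add_C_of_natDegree_le_one (Nat.lt_succ_iff.1 hdeg)
  refine ⟨a, a.2, b, b.2, ?_⟩
  change aeval u p = _
  rw [← aeval_modByMonic_eq_self_of_root hroot, hab, map_add, map_mul, aeval_C, aeval_C, aeval_X,
    add_comm]
  rfl

theorem map_eq_self_of_mem_adjoin {φ : K →ₐ[k] K} {x y : K} (hx : φ x = x) (hy : y ∈ k⟮x⟯) :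
    φ y = y := by
  obtain ⟨p, q, rfl⟩ := (mem_adjoin_simple_iff k y).1 hy
  rw [map_div₀, ← aeval_algHom_apply, ← aeval_algHom_apply, hx]

theorem exists_eq_mul_of_map_eq_neg [NeZero (2 : K)] {φ : K →ₐ[k] K} {u F : K} (hu : φ u = -u)
    (hF : F ∈ k⟮u⟯) (hφF : φ F = -F) : ∃ b ∈ k⟮u ^ 2⟯, F = b * u := by
  obtain ⟨a, ha, b, hb, rfl⟩ := exists_add_mul_of_mem_adjoin hF
  have hu2 : φ (u ^ 2) = u ^ 2 := by rw [map_pow, hu, neg_sq]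
  rw [map_add, map_mul, hu, map_eq_self_of_mem_adjoin hu2 ha, map_eq_self_of_mem_adjoin hu2 hb]
    at hφF
  have ha0 : a = 0 := (mul_eq_zero.1 (by linear_combination hφF : (2 : K) * a = 0)).resolve_left
    two_ne_zero
  exact ⟨b, hb, by rw [ha0, zero_add]⟩

end OddPart

section Substitution

open Matrix IntermediateField

theorem bracket_mulVec_genericPoint_ne_zero (S : GL (Fin 2) ℂ) (z : OnePoint ℂ) :
    bracket (S.1.map RatFunc.C *ᵥ genericPoint) (RatFunc.C ∘ homCoord z) ≠ 0 := by
  obtain ⟨c, hc⟩ := exists_mulVec_homCoord S (S⁻¹ • z)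
  rw [smul_inv_smul] at hc
  have h := bracket_mulVec_mulVec (S.1.map RatFunc.C) genericPoint
    (RatFunc.C ∘ homCoord (S⁻¹ • z))
  rw [map_mulVec_comp_of_mulVec_eq_smul RatFunc.C hc, bracket_smul_right, ← linFactor_eq_bracket,
    ← RingHom.mapMatrix_apply, ← RingHom.map_det] at h
  exact right_ne_zero_of_mul (h.trans_ne (mul_ne_zero ((map_ne_zero _).2 S.det_ne_zero)
    (linFactor_ne_zero _)))

theorem map_mulVec_genericPoint (M : Matrix (Fin 2) (Fin 2) ℂ) :
    M.map RatFunc.C *ᵥ genericPoint =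
      ![RatFunc.C (M 0 0) * RatFunc.X + RatFunc.C (M 0 1),
        RatFunc.C (M 1 0) * RatFunc.X + RatFunc.C (M 1 1)] := by
  ext i
  fin_cases i <;> simp [genericPoint, mulVec, dotProduct, Fin.sum_univ_two]

theorem mobiusFun_denom_ne_zero (S : GL (Fin 2) ℂ) :
    RatFunc.C (S 1 0) * RatFunc.X + RatFunc.C (S 1 1) ≠ 0 := by
  have h := bracket_mulVec_genericPoint_ne_zero S ∞
  rw [map_mulVec_genericPoint] at h
  simpa [bracket] using h

theorem smul_mobiusFun_one (S : GL (Fin 2) ℂ) :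
    (RatFunc.C (S 1 0) * RatFunc.X + RatFunc.C (S 1 1)) • ![mobiusFun S, 1] =
      S.1.map RatFunc.C *ᵥ genericPoint := by
  rw [map_mulVec_genericPoint, mobiusFun, smul_cons, smul_cons, smul_eq_mul, smul_eq_mul, mul_one,
    mul_div_cancel₀ _ (mobiusFun_denom_ne_zero S), smul_empty]

theorem transcendental_mobiusFun (S : GL (Fin 2) ℂ) : Transcendental ℂ (mobiusFun S) := by
  refine RatFunc.transcendental_of_ne_C _ fun ⟨c, hc⟩ =>
    bracket_mulVec_genericPoint_ne_zero S c ?_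
  rw [← smul_mobiusFun_one, bracket_smul_left]
  simp [bracket, hc]

/-- The substitution `F ↦ F(S(t))`, as an endomorphism of `ℂ(t)`. -/
def compMobiusHom (S : GL (Fin 2) ℂ) : RatFunc ℂ →ₐ[ℂ] RatFunc ℂ :=
  RatFunc.liftAlgHom (Polynomial.aeval (mobiusFun S))
    (nonZeroDivisors_le_comap_nonZeroDivisors_of_injective _
      (transcendental_iff_injective.1 (transcendental_mobiusFun S)))

theorem compMobiusHom_apply (S : GL (Fin 2) ℂ) (F : RatFunc ℂ) :
    compMobiusHom S F = compMobius F S := by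
  rw [compMobiusHom, RatFunc.liftAlgHom_apply, compMobius, RatFunc.eval]
  rfl

theorem compMobiusHom_comp_genericPoint (S : GL (Fin 2) ℂ) :
    compMobiusHom S ∘ genericPoint = ![mobiusFun S, 1] := by
  ext i
  fin_cases i
  · exact (compMobiusHom_apply S _).trans (RatFunc.eval_X _ _)
  · exact map_one _

theorem compMobiusHom_fixCoord {S : GL (Fin 2) ℂ} (hS : S.1.trace = 0) {α β : OnePoint ℂ}
    (hαβ : α ≠ β) (hα : S • α = α) (hβ : S • β = β) :
    compMobiusHom S (fixCoord α β) = -fixCoord α β := by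
  obtain ⟨k, hk, hαk, hβk⟩ := exists_eigenvalue_of_smul_eq_self hS hαβ hα hβ
  have hC (a : Fin 2 → ℂ) : compMobiusHom S ∘ RatFunc.C ∘ a = RatFunc.C ∘ a :=
    funext fun i => (compMobiusHom S).commutes (a i)
  have htrace : (S.1.map RatFunc.C).trace = 0 := by
    rw [← AddMonoidHom.map_trace RatFunc.C, hS, map_zero]
  have hk' : RatFunc.C k ≠ 0 := (map_ne_zero _).2 hk
  have hα' := map_mulVec_comp_of_mulVec_eq_smul RatFunc.C hαk
  have hβ' := map_mulVec_comp_of_mulVec_eq_smul RatFunc.C hβk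
  rw [map_neg] at hβ'
  rw [fixCoord_eq_bracketRatio, ← bracketRatio_mulVec htrace hk' hα' hβ', ← smul_mobiusFun_one,
    bracketRatio_smul (mobiusFun_denom_ne_zero S), ← compMobiusHom_comp_genericPoint]
  have h := map_bracketRatio (compMobiusHom S).toRingHom (RatFunc.C ∘ homCoord α)
    (RatFunc.C ∘ homCoord β) genericPoint
  simpa [hC] using h

theorem exists_eq_mul_fixCoord {S : GL (Fin 2) ℂ} (hS : S.1.trace = 0) {α β : OnePoint ℂ}
    (hαβ : α ≠ β) (hα : S • α = α) (hβ : S • β = β) {F : RatFunc ℂ}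
    (hF : F + compMobius F S = 0) : ∃ b ∈ ℂ⟮fixCoord α β ^ 2⟯, F = b * fixCoord α β :=
  exists_eq_mul_of_map_eq_neg (compMobiusHom_fixCoord hS hαβ hα hβ)
    (adjoin_fixCoord hαβ ▸ mem_top) (by rw [compMobiusHom_apply, eq_neg_of_add_eq_zero_right hF])

end Substitution

section RatFuncEval

open IntermediateField

universe u

variable {k K L : Type u} [Field k] [Field K] [Field L] [Algebra k K] [Algebra k L]

theorem eval_algebraMap_eq (x : K) (G : RatFunc k) : G.eval (algebraMap k K) x =
    Polynomial.aeval x G.num / Polynomial.aeval x G.denom := rfl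

theorem eval_mem_adjoin (x : K) (G : RatFunc k) : G.eval (algebraMap k K) x ∈ k⟮x⟯ :=
  (mem_adjoin_simple_iff k _).2 ⟨G.num, G.denom, rfl⟩

theorem algebraMap_eval [Algebra K L] [IsScalarTower k K L] (x : K) (G : RatFunc k) :
    algebraMap K L (G.eval (algebraMap k K) x) = G.eval (algebraMap k L) (algebraMap K L x) := by
  rw [eval_algebraMap_eq, eval_algebraMap_eq, map_div₀, Polynomial.aeval_algebraMap_apply,
    Polynomial.aeval_algebraMap_apply]

theorem eval_X_eq_self (G : RatFunc k) :
    G.eval (algebraMap k (RatFunc k)) RatFunc.X = G := by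
  rw [eval_algebraMap_eq, RatFunc.aeval_X_left_eq_algebraMap, RatFunc.aeval_X_left_eq_algebraMap,
    RatFunc.num_div_denom]

theorem exists_eval_eq_of_mem_adjoin {x g : K} (hg : g ∈ k⟮x⟯) :
    ∃ G : RatFunc k, G.eval (algebraMap k K) x = g := by
  obtain ⟨p, q, rfl⟩ := (mem_adjoin_simple_iff k g).1 hg
  by_cases hq : Polynomial.aeval x q = 0
  · exact ⟨0, by rw [RatFunc.eval_zero, hq, div_zero]⟩
  have hq0 : q ≠ 0 := fun h => hq (by rw [h, map_zero])
  set G : RatFunc k := algebraMap k[X] (RatFunc k) p / algebraMap k[X] (RatFunc k) q with hG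
  have hd : Polynomial.aeval x G.denom ≠ 0 := fun h => hq (by
    obtain ⟨r, hr⟩ := RatFunc.denom_div_dvd p q
    rw [hr, map_mul, h, zero_mul])
  refine ⟨G, ?_⟩
  rw [eval_algebraMap_eq, div_eq_div_iff hd hq, ← map_mul, ← map_mul,
    (RatFunc.num_mul_eq_mul_denom_iff hq0).2 hG]

end RatFuncEval

section SqrtField

open IntermediateField

theorem deriv_algebraMap_complex (P : ℂ[X]) (c : ℂ) : (algebraMap ℂ (SqrtField P) c)′ = 0 := by
  rw [IsScalarTower.algebraMap_apply ℂ (RatFunc ℂ) (SqrtField P), deriv_algebraMap,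
    RatFunc.algebraMap_eq_C, deriv_C, map_zero]

theorem sqrtOf_ne_zero {P : ℂ[X]} (hP : P ≠ 0) : sqrtOf P ≠ 0 := by
  refine ne_zero_pow two_ne_zero ?_
  rw [sqrtOf_sq, map_ne_zero]
  exact RatFunc.algebraMap_ne_zero hP

theorem hasElementaryIntegral_eval_mul_deriv_div {P Q : ℂ[X]} (hdeg : Q.natDegree = 2)
    (hQ : Q.Separable) {x η : SqrtField P} (hη : η ^ 2 = Polynomial.aeval x Q) (G : RatFunc ℂ) :
    HasElementaryIntegral (G.eval (algebraMap ℂ (SqrtField P)) x * x′ / (2 * η)) := by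
  refine hasElementaryIntegral_of_mem_liouvilleSpan (deriv_algebraMap_complex P) ?_
  rw [mul_div_right_comm]
  have hx : ℂ⟮x⟯ ≤ ℂ⟮x, η⟯ := adjoin.mono ℂ _ _ (Set.singleton_subset_iff.2 (Set.mem_insert x _))
  have hη' : η ∈ ℂ⟮x, η⟯ := subset_adjoin ℂ _ (Set.mem_insert_of_mem x rfl)
  exact mul_deriv_mem_liouvilleSpan_of_sq_eq (deriv_algebraMap_complex P) hdeg hQ hη
    (div_mem (hx (eval_mem_adjoin x G)) (mul_mem (ofNat_mem _ 2) hη'))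

theorem hasElementaryIntegral_div_sqrtOf {Q : ℂ[X]} (hdeg : Q.natDegree = 2) (hQ : Q.Separable)
    (G : RatFunc ℂ) :
    HasElementaryIntegral (algebraMap (RatFunc ℂ) (SqrtField Q) G / (2 * sqrtOf Q)) := by
  have h := hasElementaryIntegral_eval_mul_deriv_div hdeg hQ
    (x := algebraMap (RatFunc ℂ) (SqrtField Q) RatFunc.X) (η := sqrtOf Q)
    (by rw [sqrtOf_sq, Polynomial.aeval_algebraMap_apply, RatFunc.aeval_X_left_eq_algebraMap]) G
  rwa [← algebraMap_eval, eval_X_eq_self, deriv_algebraMap, deriv_X, map_one, mul_one] at h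

theorem exists_substitution {R Q : ℂ[X]} (hR : R ≠ 0) {u : RatFunc ℂ} (hu : u′ ≠ 0)
    (hQ : u′ ^ 2 * algebraMap ℂ[X] (RatFunc ℂ) R = Polynomial.aeval (u ^ 2) Q) (G : RatFunc ℂ) :
    ∃ x η : SqrtField R, x = algebraMap (RatFunc ℂ) (SqrtField R) (u ^ 2) ∧
      η ^ 2 = Polynomial.aeval x Q ∧
      algebraMap (RatFunc ℂ) (SqrtField R) (G.eval (algebraMap ℂ (RatFunc ℂ)) (u ^ 2) * u)
        / sqrtOf R = G.eval (algebraMap ℂ (SqrtField R)) x * x′ / (2 * η) := by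
  refine ⟨_, algebraMap (RatFunc ℂ) (SqrtField R) u′ * sqrtOf R, rfl, ?_, ?_⟩
  · rw [mul_pow, sqrtOf_sq, ← map_pow, ← map_mul, hQ, Polynomial.aeval_algebraMap_apply]
  · have hu' : algebraMap (RatFunc ℂ) (SqrtField R) u′ ≠ 0 := (map_ne_zero _).2 hu
    have hR' := sqrtOf_ne_zero hR
    rw [← algebraMap_eval, deriv_algebraMap, deriv_sq]
    simp only [map_mul, map_ofNat]
    field_simp

theorem exists_quadratic_substitution {R : ℂ[X]} (hdeg : R.natDegree = 3 ∨ R.natDegree = 4)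
    (hR : R.Separable) {S : GL (Fin 2) ℂ} (hS : S.1.trace = 0) (hSR : PermutesInPairs S R)
    {F : RatFunc ℂ} (hF : F + compMobius F S = 0) {α β : OnePoint ℂ} (hαβ : α ≠ β)
    (hfix : {z : OnePoint ℂ | S • z = z} = {α, β}) :
    ∃ (G : RatFunc ℂ) (Q : ℂ[X]), Q.natDegree = 2 ∧ Q.Separable ∧ ∃ x η : SqrtField R,
      x = algebraMap (RatFunc ℂ) (SqrtField R) (fixCoord α β ^ 2) ∧
      η ^ 2 = Polynomial.aeval x Q ∧
      algebraMap (RatFunc ℂ) (SqrtField R) F / sqrtOf R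
        = G.eval (algebraMap ℂ (SqrtField R)) x * x′ / (2 * η) := by
  have hα : S • α = α := hfix.ge (Set.mem_insert α {β})
  have hβ : S • β = β := hfix.ge (Set.mem_insert_of_mem α rfl)
  obtain ⟨Q, hdegQ, hQ, hRQ⟩ := exists_quadratic hdeg hR hS hSR hαβ hα hβ
  obtain ⟨b, hb, rfl⟩ := exists_eq_mul_fixCoord hS hαβ hα hβ hF
  obtain ⟨G, rfl⟩ := exists_eval_eq_of_mem_adjoin hb
  exact ⟨G, Q, hdegQ, hQ, exists_substitution hR.ne_zero (deriv_fixCoord_ne_zero hαβ) hRQ G⟩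

end SqrtField

end Goursat

end

open Goursat in
theorem theorem3p3 (R : ℂ[X]) (hdeg : R.natDegree = 3 ∨ R.natDegree = 4) (hR : R.Separable)
    (S : GL (Fin 2) ℂ) (hS : IsMobiusInvolution S) (hSR : PermutesInPairs S R)
    (F : RatFunc ℂ) (hF : F + compMobius F S = 0) :
    IsPseudoElliptic R F ∧
    (∃ α β : OnePoint ℂ, α ≠ β ∧ {z : OnePoint ℂ | S • z = z} = {α, β}) ∧
    ∀ α β : OnePoint ℂ, α ≠ β → {z : OnePoint ℂ | S • z = z} = {α, β} →
      ∃ (G : RatFunc ℂ) (Q : ℂ[X]), Q.natDegree = 2 ∧ Q.Separable ∧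
        -- `∫ F(t) dt / √(R(t)) = ∫ G(x) dx / (2 √(Q(x)))` under the substitution `x = u ^ 2`:
        -- the integrands agree in `ℂ(t, √R)`, where `η` is the square root of `Q(x)`
        (∃ x η : SqrtField R,
          x = algebraMap (RatFunc ℂ) (SqrtField R) (fixCoord α β ^ 2) ∧
          η ^ 2 = Q.eval₂ (algebraMap ℂ (SqrtField R)) x ∧
          algebraMap (RatFunc ℂ) (SqrtField R) F / sqrtOf R
            = RatFunc.eval (algebraMap ℂ (SqrtField R)) x G * x′ / (2 * η)) ∧
        -- `∫ G(x) dx / (2 √(Q(x)))` is elementary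
        HasElementaryIntegral (algebraMap (RatFunc ℂ) (SqrtField Q) G / (2 * sqrtOf Q)) := by
  have htrace := trace_eq_zero_of_sq_mem_center hS.1 hS.2
  obtain ⟨α, β, hαβ, hfix⟩ := exists_setOf_smul_eq_self htrace
  refine ⟨?_, ⟨α, β, hαβ, hfix⟩, fun α β hαβ hfix => ?_⟩ <;>
    obtain ⟨G, Q, hdegQ, hQ, x, η, hx, hη, hsubst⟩ :=
      exists_quadratic_substitution hdeg hR htrace hSR hF hαβ hfix
  · rw [IsPseudoElliptic, hsubst]
    exact hasElementaryIntegral_eval_mul_deriv_div hdegQ hQ hη G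
  · exact ⟨G, Q, hdegQ, hQ, ⟨x, η, hx, hη, hsubst⟩, hasElementaryIntegral_div_sqrtOf hdegQ hQ G⟩
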